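/- Let $\mathcal A$ be a finite set of actions and let $n,m\ge 1$. Task $i\in\{1,\dots,n\}$ is given by distributions $\rho_i(\cdot\mid a)$, $a\in\mathcal A$, of rewards in $[0,1]$. The training sets $D_i=\{(a_{ij},r_{ij})\}_{j=1}^m$, $i=1,\dots,n$, are generated sequentially by $a_{ij}\sim b_{ij}(\cdot\mid D_1,\dots,D_{i-1},D_i^{:j-1})$ and $r_{ij}\sim\rho_i(\cdot\mid a_{ij})$, where $D_i^{:k}$ denotes the first $k$ pairs of $D_i$ and the behaviour policies $b_{ij}$ are probability distributions on $\mathcal A$ that may depend on all previously observed training data. Write $b_{ij}(a)$ for the resulting conditional probability of $a$, and $b_{\min}=\min_{i\le n,\,j\le m,\,a\in\mathcal A}b_{ij}(a)$. Let $A$ be a deterministic learning algorithm that maps a data set $D$ and a prior $P$ (a probability distribution on $\mathcal A$) to a posterior $A(D,P)$ on $\mathcal A$, measurably in $P$. Put $$R_i(a)=\mathbb E_{r\sim\rho_i(\cdot\mid a)}[r],\qquad \widehat R_i(a,D_i)=\frac1m\sum_{j=1}^m\frac{1}{b_{ij}(a_{ij})}\,r_{ij}\,\mathbb I\{a_{ij}=a\},$$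 let $R_i(Q)$ and $\widehat R_i(Q,D_i)$ be their expectations over $a\sim Q$, and for a probability distribution $\mathcal Q$ on the set of priors put $$\widetilde{\mathcal R}(\mathcal Q)=\mathbb E_{P\sim\mathcal Q}\Big[\frac1n\sum_{i=1}^n\frac1m\sum_{j=1}^m R_i(A(D_i^{:j-1},P))\Big],\qquad \widehat{\mathcal R}(\mathcal Q)=\mathbb E_{P\sim\mathcal Q}\Big[\frac1n\sum_{i=1}^n\frac1m\sum_{j=1}^m \widehat R_i(A(D_i^{:j-1},P),D_i)\Big].$$ Then for every probability distribution $\mathcal P$ on the set of priors (the hyperprior, fixed independently of the data), every $\lambda\ge 0$ and every $\delta\in(0,1]$, with probability at least $1-\delta$ over the training sets $D_1,\dots,D_n$ the following holds: if $\lambda\in[0,m\,b_{\min}]$, then for all probability distributions $\mathcal Q$ on the set of priors (the hyperposteriors, which may depend on the data) $$\widetilde{\mathcal R}(\mathcal Q)\ \ge\ \widehat{\mathcal R}(\mathcal Q)-\frac{1}{n\lambda}D_{\mathrm{KL}}(\mathcal Q\|\mathcal P)-\frac{1}{nm\lambda}\,\mathbb E_{P\sim\mathcal Q}\Big[\sum_{i=1}^n\sum_{j=1}^m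 D_{\mathrm{KL}}\big(A(D_i^{:j-1},P)\,\|\,P\big)\Big]-\frac{\lambda(e-2)}{b_{\min}\,m}-\frac{1}{n\lambda}\ln\frac{m}{\delta}.$$ Here the KL divergences may be infinite, and for $\lambda=0$ a quotient with positive numerator and denominator $0$ is read as $+\infty$, while $0/0=0$. -/

import Mathlib

open MeasureTheory ProbabilityTheory
open scoped ENNReal

noncomputable section

namespace LifelongBandit

/-- One observation: an action together with a reward in `[0, 1]`. -/
abbrev Obs (𝒜 : Type*) := 𝒜 × unitInterval

/-- A data set consisting of `k` action-reward pairs. -/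
abbrev DataSet (𝒜 : Type*) (k : ℕ) := Fin k → Obs 𝒜

/-- The data available just before step `j` of task `i` (both counted from `0`): the complete data
sets of the tasks `0, …, i - 1`, and the first `j` observations of task `i`. -/
abbrev History (𝒜 : Type*) (m i j : ℕ) := (Fin i → DataSet 𝒜 m) × DataSet 𝒜 j

/-- The first `j` observations of a data set. -/
def truncate {𝒜 : Type*} {m : ℕ} (d : DataSet 𝒜 m) (j : Fin m) : DataSet 𝒜 (j : ℕ) :=
  fun l => d (Fin.castLE j.isLt.le l)

/-- The part of the training data `D` that is available just before step `j` of task `i`. -/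
def history {𝒜 : Type*} {n m : ℕ} (D : Fin n → DataSet 𝒜 m) (i : Fin n) (j : Fin m) :
    History 𝒜 m (i : ℕ) (j : ℕ) :=
  (fun k => D (Fin.castLE i.isLt.le k), truncate (D i) j)

/-- A deterministic base learning algorithm: it maps a data set (of any size) and a prior over
actions to a posterior over actions. -/
abbrev LearningAlgorithm (𝒜 : Type*) [MeasurableSpace 𝒜] :=
  (k : ℕ) → DataSet 𝒜 k → ProbabilityMeasure 𝒜 → ProbabilityMeasure 𝒜

section Law

variable {𝒜 : Type*} [MeasurableSpace 𝒜] {m : ℕ}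

lemma measurable_snoc {Z : Type*} [MeasurableSpace Z] (k : ℕ) :
    Measurable (fun x : (Fin k → Z) × Z => (Fin.snoc x.1 x.2 : Fin (k + 1) → Z)) := by
  refine measurable_pi_lambda _ fun l => ?_
  refine Fin.lastCases ?_ (fun l => ?_) l
  · simpa using measurable_snd
  · simpa [Function.comp_def] using (measurable_pi_apply l).comp measurable_fst

/-- The conditional law, given the data sets of the tasks `0, …, i - 1`, of the first `k`
observations of task `i`: at each step the action is drawn from the behaviour policy `b i k`
evaluated at all the data observed so far, and then the reward is drawn from `ρ i` given the
action. -/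
def taskLaw (b : (i j : ℕ) → Kernel (History 𝒜 m i j) 𝒜) (ρ : ℕ → Kernel 𝒜 unitInterval)
    (i : ℕ) : (k : ℕ) → Kernel (Fin i → DataSet 𝒜 m) (DataSet 𝒜 k)
  | 0 => Kernel.const _ (Measure.dirac Fin.elim0)
  | k + 1 => (taskLaw b ρ i k ⊗ₖ (b i k ⊗ₖ Kernel.prodMkLeft (History 𝒜 m i k) (ρ i))).map
      (fun x => Fin.snoc x.1 x.2)

/-- The joint law of the training data sets of the first `n` tasks, for tasks with reward
distributions `ρ 0, ρ 1, …` and behaviour policies `b i j`. -/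
def trainingLaw (b : (i j : ℕ) → Kernel (History 𝒜 m i j) 𝒜) (ρ : ℕ → Kernel 𝒜 unitInterval) :
    (n : ℕ) → Measure (Fin n → DataSet 𝒜 m)
  | 0 => Measure.dirac Fin.elim0
  | n + 1 => (trainingLaw b ρ n ⊗ₘ taskLaw b ρ n m).map (fun x => Fin.snoc x.1 x.2)

instance isMarkovKernel_taskLaw (b : (i j : ℕ) → Kernel (History 𝒜 m i j) 𝒜)
    (ρ : ℕ → Kernel 𝒜 unitInterval) [∀ i j, IsMarkovKernel (b i j)] [∀ i, IsMarkovKernel (ρ i)]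
    (i k : ℕ) : IsMarkovKernel (taskLaw b ρ i k) := by
  induction k with
  | zero => unfold taskLaw; infer_instance
  | succ k ih => unfold taskLaw; exact Kernel.IsMarkovKernel.map _ (measurable_snoc k)

instance isProbabilityMeasure_trainingLaw (b : (i j : ℕ) → Kernel (History 𝒜 m i j) 𝒜)
    (ρ : ℕ → Kernel 𝒜 unitInterval) [∀ i j, IsMarkovKernel (b i j)] [∀ i, IsMarkovKernel (ρ i)]
    (n : ℕ) : IsProbabilityMeasure (trainingLaw b ρ n) := by
  induction n with
  | zero => unfold trainingLaw; infer_instance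
  | succ n ih =>
    unfold trainingLaw
    exact Measure.isProbabilityMeasure_map (measurable_snoc n).aemeasurable

end Law

section Rewards

variable {𝒜 : Type*} [MeasurableSpace 𝒜] {n m : ℕ}

/-- The probability `b_{ij}(a)` that the behaviour policy, given the data observed before step `j`
of task `i`, assigns to the action `a`. -/
def behaviourProb (b : (i j : ℕ) → Kernel (History 𝒜 m i j) 𝒜) (D : Fin n → DataSet 𝒜 m)
    (i : Fin n) (j : Fin m) (a : 𝒜) : ℝ :=
  (b i j (history D i j)).real {a}

/-- `b_min`: the smallest of the numbers `b_{ij}(a)` (a minimum over a finite set when `𝒜` is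
finite), for the observed training data `D`. -/
def bMin (b : (i j : ℕ) → Kernel (History 𝒜 m i j) 𝒜) (D : Fin n → DataSet 𝒜 m) : ℝ :=
  ⨅ t : Fin n × Fin m × 𝒜, behaviourProb b D t.1 t.2.1 t.2.2

/-- The expected reward `R_i(a)` of the action `a` under the reward distribution `ρ`. -/
def reward (ρ : Kernel 𝒜 unitInterval) (a : 𝒜) : ℝ := ∫ r, (r : ℝ) ∂(ρ a)

open scoped Classical in
/-- The importance-weighted empirical estimate of the reward of the action `a` in task `i`. -/
def empReward (b : (i j : ℕ) → Kernel (History 𝒜 m i j) 𝒜) (D : Fin n → DataSet 𝒜 m)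
    (i : Fin n) (a : 𝒜) : ℝ :=
  (1 / m : ℝ) * ∑ j : Fin m,
    1 / behaviourProb b D i j (D i j).1 * ((D i j).2 : ℝ) * (if (D i j).1 = a then 1 else 0)

/-- The expected multi-task reward of the hyperposterior `𝒬`. -/
def expMultiTaskReward (A : LearningAlgorithm 𝒜) (ρ : ℕ → Kernel 𝒜 unitInterval)
    (D : Fin n → DataSet 𝒜 m) (𝒬 : Measure (ProbabilityMeasure 𝒜)) : ℝ :=
  ∫ P, (1 / n : ℝ) * ∑ i : Fin n, (1 / m : ℝ) * ∑ j : Fin m,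
    ∫ a, reward (ρ i) a ∂(A j (truncate (D i) j) P : Measure 𝒜) ∂𝒬

/-- The empirical multi-task reward of the hyperposterior `𝒬`. -/
def empMultiTaskReward (A : LearningAlgorithm 𝒜) (b : (i j : ℕ) → Kernel (History 𝒜 m i j) 𝒜)
    (D : Fin n → DataSet 𝒜 m) (𝒬 : Measure (ProbabilityMeasure 𝒜)) : ℝ :=
  ∫ P, (1 / n : ℝ) * ∑ i : Fin n, (1 / m : ℝ) * ∑ j : Fin m,
    ∫ a, empReward b D i a ∂(A j (truncate (D i) j) P : Measure 𝒜) ∂𝒬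

/-- The expectation over `P ∼ 𝒬` of the sum over all tasks and steps of the KL divergences between
the posteriors of the base learning algorithm and the prior `P`. -/
def expPosteriorKL (A : LearningAlgorithm 𝒜) (D : Fin n → DataSet 𝒜 m)
    (𝒬 : Measure (ProbabilityMeasure 𝒜)) : ℝ≥0∞ :=
  ∫⁻ P, ∑ i : Fin n, ∑ j : Fin m,
    InformationTheory.klDiv (A j (truncate (D i) j) P : Measure 𝒜) (P : Measure 𝒜) ∂𝒬

end Rewards

end LifelongBandit

end

/-! Fix one action `c i` per task and put t = λ/m. Given the history, the importance-weighted reward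
U of `c i` has mean R and satisfies 0 ≤ U ≤ 1/p, where p is the behaviour probability of `c i`;
hence its second moment is at most 1/p. For t ≤ p, Bernstein's argument bounds the conditional mean
of exp(t(U - R) - (e-2)t²/p) by 1 (`lintegral_exp_bernstein_le_one`). Since b_min is random, the
factor is set to 1 when p < t, so the bound holds for every history and the product over all steps
has mean at most 1 (`lintegral_historyProd_trainingLaw_le_one`).

These products are averaged over action sequences α with the data-free weights E_P ∏ P(α_i), P drawn
from the hyperprior. Because 𝒜 is finite this is a finite sum, and no measurability jointly in data
and priors is needed. Markov's inequality bounds the average by 1/δ outside an event of probability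
δ. If λ ≤ m b_min, no factor is cut off.

The rest is deterministic in D: the Donsker–Varadhan inequality is applied once to pass from
hyperprior to hyperposterior and once for each pair (i, j) to pass from the prior to the posterior
(`integral_sum_posterior_le`). The exponent h_i is the same for all j, so no union bound over j
occurs; the m in ln(m/δ) is slack. -/

noncomputable section

namespace LifelongBandit

/-! ### Exponential inequalities and change of measure -/

section Analysis

/-- Termwise comparison of series: x^(k+2) ≤ x² on [0, 1], and the sum of 1/(k+2)! over k ≥ 0 is e -
2. -/
lemma exp_le_one_add_add_sq_of_nonneg {x : ℝ} (hx0 : 0 ≤ x) (hx1 : x ≤ 1) :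
    Real.exp x ≤ 1 + x + (Real.exp 1 - 2) * x ^ 2 := by
  have key : ∀ y : ℝ, HasSum (fun k : ℕ => y ^ (k + 2) / (k + 2).factorial)
      (Real.exp y - (1 + y)) := by
    intro y
    have h := NormedSpace.expSeries_div_hasSum_exp (𝔸 := ℝ) y
    rw [← Real.exp_eq_exp_ℝ] at h
    have h2 := (hasSum_nat_add_iff' 2).mpr h
    simpa [Finset.sum_range_succ] using h2
  have h1 := (key 1).mul_right (x ^ 2)
  have := hasSum_le (fun k => ?_) (key x) h1
  · linarith
  · rw [one_pow, pow_add, div_mul_eq_mul_div, one_mul]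
    gcongr
    exact mul_le_of_le_one_left (sq_nonneg x) (pow_le_one₀ hx0 hx1)

lemma exp_le_one_add_add_sq {x : ℝ} (hx1 : x ≤ 1) :
    Real.exp x ≤ 1 + x + (Real.exp 1 - 2) * x ^ 2 := by
  rcases le_total 0 x with hx0 | hx0
  · exact exp_le_one_add_add_sq_of_nonneg hx0 hx1
  have h := Real.quadratic_le_exp_of_nonneg (neg_nonneg.mpr hx0)
  have he := Real.quadratic_le_exp_of_nonneg zero_le_one
  have hmul : Real.exp x * Real.exp (-x) = 1 := by rw [← Real.exp_add]; simp
  have h2 : Real.exp x * (1 + -x + (-x) ^ 2 / 2) ≤ 1 :=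
    (mul_le_mul_of_nonneg_left h (Real.exp_pos x).le).trans_eq hmul
  -- Here (1 + x + x²/2)(1 - x + x²/2) = 1 + x⁴/4 ≥ 1. The final step uses 1/2 ≤ e - 2.
  have h3 : Real.exp x ≤ 1 + x + x ^ 2 / 2 := by
    have hq : 0 < 1 + -x + (-x) ^ 2 / 2 := by nlinarith
    refine le_of_mul_le_mul_right (h2.trans ?_) hq
    nlinarith [sq_nonneg (x ^ 2)]
  nlinarith [sq_nonneg x]

lemma integrable_of_abs_le {Ω : Type*} [MeasurableSpace Ω] {μ : Measure Ω} [IsFiniteMeasure μ]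
    {f : Ω → ℝ} (hf : Measurable f) {C : ℝ} (hC : ∀ x, |f x| ≤ C) : Integrable f μ :=
  Integrable.of_bound hf.aestronglyMeasurable C (.of_forall hC)

/-- Bernstein's bound for the exponential moment of a bounded importance-weighted estimate. -/
lemma lintegral_exp_bernstein_le_one {Ω : Type*} [MeasurableSpace Ω] {μ : Measure Ω}
    [IsProbabilityMeasure μ] {U : Ω → ℝ} (hU : Measurable U) {p t R : ℝ} (hp : 0 < p)
    (hU0 : ∀ x, 0 ≤ U x) (hU1 : ∀ x, U x ≤ 1 / p) (hR : ∫ x, U x ∂μ = R) (hR1 : R ≤ 1)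
    (ht0 : 0 ≤ t) (htp : t ≤ p) :
    ∫⁻ x, ENNReal.ofReal (Real.exp (t * (U x - R) - (Real.exp 1 - 2) * t ^ 2 / p)) ∂μ ≤ 1 := by
  have hR0 : 0 ≤ R := hR ▸ integral_nonneg hU0
  have he := Real.quadratic_le_exp_of_nonneg zero_le_one
  have htp' : t * (1 / p) ≤ 1 := by rw [mul_one_div]; exact div_le_one_of_le₀ htp hp.le
  set c := Real.exp 1 - 2 with hc
  have hc0 : 0 ≤ c := by linarith
  have hUi : Integrable U μ := integrable_of_abs_le hU (C := 1 / p) fun x => by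
    rw [abs_of_nonneg (hU0 x)]; exact hU1 x
  -- Replacing U² by U/p makes the majorant affine in U, so only the mean of U enters after
  -- integration.
  have hpt : ∀ x, Real.exp (t * (U x - R)) ≤
      (1 - t * R + c * t ^ 2 * R ^ 2) + (t + c * t ^ 2 * (1 / p - 2 * R)) * U x := by
    intro x
    have h1 : t * (U x - R) ≤ 1 := by
      have := mul_le_mul_of_nonneg_left (hU1 x) ht0
      nlinarith [mul_nonneg ht0 hR0]
    refine (exp_le_one_add_add_sq h1).trans ?_
    have h2 : U x * U x ≤ 1 / p * U x := mul_le_mul_of_nonneg_right (hU1 x) (hU0 x)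
    have h3 : 0 ≤ c * t ^ 2 := by positivity
    rw [← hc]
    nlinarith [mul_le_mul_of_nonneg_left h2 h3]
  have hmeas : Measurable fun x => Real.exp (t * (U x - R) - c * t ^ 2 / p) := by fun_prop
  have hint : Integrable (fun x => (1 - t * R + c * t ^ 2 * R ^ 2) +
      (t + c * t ^ 2 * (1 / p - 2 * R)) * U x) μ :=
    (integrable_const _).add (hUi.const_mul _)
  have hle : ∀ x, Real.exp (t * (U x - R) - c * t ^ 2 / p) ≤
      Real.exp (-(c * t ^ 2 / p)) * ((1 - t * R + c * t ^ 2 * R ^ 2) +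
      (t + c * t ^ 2 * (1 / p - 2 * R)) * U x) := fun x => by
    rw [sub_eq_neg_add, Real.exp_add]
    exact mul_le_mul_of_nonneg_left (hpt x) (Real.exp_pos _).le
  calc _ ≤ ∫⁻ x, ENNReal.ofReal (Real.exp (-(c * t ^ 2 / p)) * ((1 - t * R + c * t ^ 2 * R ^ 2) +
      (t + c * t ^ 2 * (1 / p - 2 * R)) * U x)) ∂μ :=
        lintegral_mono fun x => ENNReal.ofReal_le_ofReal (hle x)
    _ = ENNReal.ofReal (∫ x, Real.exp (-(c * t ^ 2 / p)) * ((1 - t * R + c * t ^ 2 * R ^ 2) +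
      (t + c * t ^ 2 * (1 / p - 2 * R)) * U x) ∂μ) :=
        (ofReal_integral_eq_lintegral_ofReal (hint.const_mul _)
          (.of_forall fun x => (Real.exp_pos _).le.trans (hle x))).symm
    _ ≤ 1 := by
      rw [integral_const_mul, integral_add (integrable_const _) (hUi.const_mul _),
        integral_const_mul, hR, integral_const, ENNReal.ofReal_le_one]
      simp only [probReal_univ, one_smul]
      rw [Real.exp_neg, inv_mul_le_one₀ (Real.exp_pos _)]
      refine le_trans ?_ (Real.add_one_le_exp _)
      have h1 : c * t ^ 2 * (R * (1 / p)) ≤ c * t ^ 2 * (1 * (1 / p)) := by gcongr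
      have h2 : 0 ≤ c * t ^ 2 * R ^ 2 := by positivity
      have h3 : c * t ^ 2 / p = c * t ^ 2 * (1 * (1 / p)) := by ring
      rw [h3]
      nlinarith

/-- The Donsker–Varadhan inequality for bounded functions. -/
lemma integral_le_toReal_klDiv_add_log {Ω : Type*} [MeasurableSpace Ω] {μ ν : Measure Ω}
    [IsProbabilityMeasure μ] [IsProbabilityMeasure ν] {f : Ω → ℝ} (hf : Measurable f) {C : ℝ}
    (hC : ∀ x, |f x| ≤ C) (hkl : InformationTheory.klDiv μ ν ≠ ∞) :
    ∫ x, f x ∂μ ≤ (InformationTheory.klDiv μ ν).toReal + Real.log (∫ x, Real.exp (f x) ∂ν) := by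
  obtain ⟨hac, hllr⟩ := InformationTheory.klDiv_ne_top_iff.mp hkl
  have hfμ : Integrable f μ := integrable_of_abs_le hf hC
  have hfν : Integrable (fun x => Real.exp (f x)) ν :=
    integrable_of_abs_le (by fun_prop) (C := Real.exp C) fun x => by
      rw [Real.abs_exp]; exact Real.exp_le_exp.mpr ((le_abs_self _).trans (hC x))
  have := isProbabilityMeasure_tilted hfν
  have hac' : μ ≪ ν.tilted f := hac.trans (absolutelyContinuous_tilted hfν)
  -- The inequality is the nonnegativity of the divergence of μ from the tilted measure `ν.tilted
  -- f`.
  have h0 := InformationTheory.integral_llr_add_sub_measure_univ_nonneg hac'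
    (integrable_llr_tilted_right hac hfμ hllr hfν)
  rw [integral_llr_tilted_right hac hfμ hfν hllr] at h0
  rw [InformationTheory.toReal_klDiv_of_measure_eq hac (by simp)]
  simp only [probReal_univ] at h0
  linarith

end Analysis

/-! ### Appending one observation or one task to a product over the history -/

section Snoc

variable {𝒜 : Type*} {m : ℕ}

/-- The product over the first `k` steps of task `i` of factors that depend on the history and on
the current observation. -/
def stepProd (y : (i j : ℕ) → History 𝒜 m i j → Obs 𝒜 → ℝ≥0∞) (i k : ℕ)
    (past : Fin i → DataSet 𝒜 m) (d : DataSet 𝒜 k) : ℝ≥0∞ :=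
  ∏ j : Fin k, y i j (past, truncate d j) (d j)

lemma truncate_snoc_castSucc {k : ℕ} (d : DataSet 𝒜 k) (x : Obs 𝒜) (j : Fin k) :
    truncate (Fin.snoc d x : DataSet 𝒜 (k + 1)) j.castSucc = truncate d j := by
  funext l
  exact Fin.snoc_castSucc (α := fun _ => Obs 𝒜) x d (Fin.castLE j.isLt.le l)

lemma truncate_snoc_last {k : ℕ} (d : DataSet 𝒜 k) (x : Obs 𝒜) :
    truncate (Fin.snoc d x : DataSet 𝒜 (k + 1)) (Fin.last k) = d := by
  funext l
  exact Fin.snoc_castSucc (α := fun _ => Obs 𝒜) x d l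

lemma stepProd_snoc (y : (i j : ℕ) → History 𝒜 m i j → Obs 𝒜 → ℝ≥0∞) (i k : ℕ)
    (past : Fin i → DataSet 𝒜 m) (d : DataSet 𝒜 k) (x : Obs 𝒜) :
    stepProd y i (k + 1) past (Fin.snoc d x) = stepProd y i k past d * y i k (past, d) x := by
  unfold stepProd
  rw [Fin.prod_univ_castSucc]
  congr 1
  · refine Finset.prod_congr rfl fun j _ => ?_
    rw [truncate_snoc_castSucc, Fin.snoc_castSucc]
    rfl
  · rw [truncate_snoc_last, Fin.snoc_last]
    rfl

/-- The product over all steps of the first `n` tasks of factors that depend on the history and on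
the current observation. -/
def historyProd (y : (i j : ℕ) → History 𝒜 m i j → Obs 𝒜 → ℝ≥0∞) {n : ℕ}
    (D : Fin n → DataSet 𝒜 m) : ℝ≥0∞ :=
  ∏ i : Fin n, ∏ j : Fin m, y i j (history D i j) (D i j)

lemma historyProd_snoc {y : (i j : ℕ) → History 𝒜 m i j → Obs 𝒜 → ℝ≥0∞} {n : ℕ} (D : Fin n → DataSet 𝒜 m) (d : DataSet 𝒜 m) :
    historyProd y (Fin.snoc D d : Fin (n + 1) → DataSet 𝒜 m) =
      historyProd y D * stepProd y n m D d := by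
  unfold historyProd stepProd
  rw [Fin.prod_univ_castSucc]
  congr 1
  · refine Finset.prod_congr rfl fun i _ => Finset.prod_congr rfl fun j _ => ?_
    have : history (Fin.snoc D d : Fin (n + 1) → DataSet 𝒜 m) i.castSucc j = history D i j := by
      unfold history
      rw [Fin.snoc_castSucc (α := fun _ => DataSet 𝒜 m)]
      refine Prod.ext (funext fun k => ?_) rfl
      exact Fin.snoc_castSucc (α := fun _ => DataSet 𝒜 m) d D (Fin.castLE i.isLt.le k)
    rw [this, Fin.snoc_castSucc]
    rfl
  · refine Finset.prod_congr rfl fun j _ => ?_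
    have : history (Fin.snoc D d : Fin (n + 1) → DataSet 𝒜 m) (Fin.last n) j =
        (D, truncate d j) := by
      unfold history
      rw [Fin.snoc_last (α := fun _ => DataSet 𝒜 m)]
      refine Prod.ext (funext fun k => ?_) rfl
      exact Fin.snoc_castSucc (α := fun _ => DataSet 𝒜 m) d D k
    rw [this, Fin.snoc_last]
    rfl

end Snoc

/-! ### Products of factors with conditional mean at most 1 -/

section Supermartingale

variable {𝒜 : Type*} [MeasurableSpace 𝒜] {m : ℕ}

lemma measurable_truncate {k : ℕ} (j : Fin k) :
    Measurable fun d : DataSet 𝒜 k => truncate d j :=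
  measurable_pi_lambda _ fun _ => measurable_pi_apply _

lemma measurable_stepProd {y : (i j : ℕ) → History 𝒜 m i j → Obs 𝒜 → ℝ≥0∞}
    (hy : ∀ i j, Measurable fun x : History 𝒜 m i j × Obs 𝒜 => y i j x.1 x.2) (i k : ℕ) :
    Measurable fun x : (Fin i → DataSet 𝒜 m) × DataSet 𝒜 k => stepProd y i k x.1 x.2 := by
  unfold stepProd
  refine Finset.measurable_prod _ fun j _ => ?_
  exact (hy i j).comp ((measurable_fst.prodMk ((measurable_truncate j).comp measurable_snd)).prodMk
    ((measurable_pi_apply j).comp measurable_snd))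

variable {b : (i j : ℕ) → Kernel (History 𝒜 m i j) 𝒜} {ρ : ℕ → Kernel 𝒜 unitInterval}
  [∀ i j, IsMarkovKernel (b i j)] [∀ i, IsMarkovKernel (ρ i)]
  {y : (i j : ℕ) → History 𝒜 m i j → Obs 𝒜 → ℝ≥0∞}

/-- The newest observation is integrated out first: given the earlier ones, its factor has mean at
most 1. -/
lemma lintegral_stepProd_taskLaw_le_one
    (hy : ∀ i j, Measurable fun x : History 𝒜 m i j × Obs 𝒜 => y i j x.1 x.2)
    (hy1 : ∀ i j h, ∫⁻ x, y i j h x ∂((b i j ⊗ₖ Kernel.prodMkLeft _ (ρ i)) h) ≤ 1)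
    (i k : ℕ) (past : Fin i → DataSet 𝒜 m) :
    ∫⁻ d, stepProd y i k past d ∂(taskLaw b ρ i k past) ≤ 1 := by
  induction k with
  | zero => simp [stepProd]
  | succ k ih =>
    have hmeas : Measurable fun d => stepProd y i (k + 1) past d :=
      (measurable_stepProd hy i (k + 1)).comp measurable_prodMk_left
    have hmeas' : Measurable fun d => stepProd y i k past d :=
      (measurable_stepProd hy i k).comp measurable_prodMk_left
    have hstep : Measurable fun x : DataSet 𝒜 k × Obs 𝒜 => y i k (past, x.1) x.2 :=
      (hy i k).comp ((measurable_const.prodMk measurable_fst).prodMk measurable_snd)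
    rw [taskLaw, Kernel.lintegral_map _ (measurable_snoc k) _ hmeas]
    simp_rw [stepProd_snoc]
    have hmul : Measurable fun x : DataSet 𝒜 k × Obs 𝒜 =>
        stepProd y i k past x.1 * y i k (past, x.1) x.2 := (hmeas'.comp measurable_fst).mul hstep
    rw [Kernel.lintegral_compProd _ _ _ hmul]
    refine le_trans (lintegral_mono fun d => ?_) ih
    have hstep' : Measurable fun x => y i k (past, d) x := hstep.comp measurable_prodMk_left
    dsimp only
    rw [lintegral_const_mul _ hstep']
    exact mul_le_of_le_one_right' (hy1 i k (past, d))

lemma measurable_history {n : ℕ} (i : Fin n) (j : Fin m) :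
    Measurable fun D : Fin n → DataSet 𝒜 m => history D i j :=
  (measurable_pi_lambda _ fun _ => measurable_pi_apply _).prodMk
    ((measurable_truncate j).comp (measurable_pi_apply i))

lemma measurable_historyProd
    (hy : ∀ i j, Measurable fun x : History 𝒜 m i j × Obs 𝒜 => y i j x.1 x.2) (n : ℕ) :
    Measurable fun D : Fin n → DataSet 𝒜 m => historyProd y D := by
  unfold historyProd
  refine Finset.measurable_prod _ fun i _ => Finset.measurable_prod _ fun j _ => ?_
  exact (hy i j).comp ((measurable_history i j).prodMk
    ((measurable_pi_apply j).comp (measurable_pi_apply i)))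

/-- The same induction one level up, with the whole last task as the newest observation. -/
lemma lintegral_historyProd_trainingLaw_le_one
    (hy : ∀ i j, Measurable fun x : History 𝒜 m i j × Obs 𝒜 => y i j x.1 x.2)
    (hy1 : ∀ i j h, ∫⁻ x, y i j h x ∂((b i j ⊗ₖ Kernel.prodMkLeft _ (ρ i)) h) ≤ 1) (n : ℕ) :
    ∫⁻ D, historyProd y D ∂(trainingLaw b ρ n) ≤ 1 := by
  induction n with
  | zero => simp [historyProd]
  | succ n ih =>
    have hstep := measurable_stepProd hy n m
    have hprod := measurable_historyProd hy n
    rw [trainingLaw, lintegral_map (measurable_historyProd hy (n + 1)) (measurable_snoc n)]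
    simp_rw [historyProd_snoc]
    have hmul : Measurable fun x : (Fin n → DataSet 𝒜 m) × DataSet 𝒜 m =>
        historyProd y x.1 * stepProd y n m x.1 x.2 := (hprod.comp measurable_fst).mul hstep
    rw [Measure.lintegral_compProd hmul]
    refine le_trans (lintegral_mono fun D => ?_) ih
    have hstep' : Measurable fun x => stepProd y n m D x := hstep.comp measurable_prodMk_left
    dsimp only
    rw [lintegral_const_mul _ hstep']
    exact mul_le_of_le_one_right' (lintegral_stepProd_taskLaw_le_one hy hy1 n m D)

end Supermartingale

/-! ### Mixtures over the hyperprior -/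

section HyperPrior

variable {𝒜 : Type*} [MeasurableSpace 𝒜]

/-- The probability of the actions `α 0, …, α (n - 1)` when a prior is drawn from the hyperprior,
and then the actions independently from that prior. -/
def mixtureWeight (HP : Measure (ProbabilityMeasure 𝒜)) {n : ℕ} (α : Fin n → 𝒜) : ℝ :=
  ∫ P, ∏ i, (P : Measure 𝒜).real {α i} ∂HP

lemma mixtureWeight_nonneg (HP : Measure (ProbabilityMeasure 𝒜)) {n : ℕ} (α : Fin n → 𝒜) :
    0 ≤ mixtureWeight HP α :=
  integral_nonneg fun _ => Finset.prod_nonneg fun _ _ => measureReal_nonneg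

lemma abs_integral_action_le (P : ProbabilityMeasure 𝒜) {f : 𝒜 → ℝ} {C : ℝ}
    (hf : ∀ a, |f a| ≤ C) : |∫ a, f a ∂(P : Measure 𝒜)| ≤ C := by
  simpa using norm_integral_le_of_norm_le_const (μ := (P : Measure 𝒜)) (f := f) (.of_forall hf)

lemma measurable_real_singleton [MeasurableSingletonClass 𝒜] (a : 𝒜) :
    Measurable fun P : ProbabilityMeasure 𝒜 => (P : Measure 𝒜).real {a} :=
  ((Measure.measurable_coe (measurableSet_singleton a)).comp
    measurable_subtype_coe).ennreal_toReal

end HyperPrior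

/-! ### Two-level change of measure for finitely many actions -/

section FiniteActions

variable {𝒜 : Type*} [Fintype 𝒜] [MeasurableSpace 𝒜] [MeasurableSingletonClass 𝒜]

lemma integral_eq_sum_real_mul (P : ProbabilityMeasure 𝒜) (f : 𝒜 → ℝ) :
    ∫ a, f a ∂(P : Measure 𝒜) = ∑ a, (P : Measure 𝒜).real {a} * f a := by
  rw [integral_fintype .of_finite]
  simp

lemma measurable_integral_action (f : 𝒜 → ℝ) :
    Measurable fun P : ProbabilityMeasure 𝒜 => ∫ a, f a ∂(P : Measure 𝒜) := by
  simp_rw [integral_eq_sum_real_mul]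
  exact Finset.measurable_sum _ fun a _ => (measurable_real_singleton a).mul_const _

lemma exists_abs_le {ι : Type*} [Finite ι] (f : ι → ℝ) : ∃ C, ∀ a, |f a| ≤ C := by
  obtain ⟨C, hC⟩ := (Set.finite_range fun a => |f a|).bddAbove
  exact ⟨C, fun a => hC ⟨a, rfl⟩⟩

/-- Expanding the product of finite sums over actions moves all dependence on the prior into the
weights, which are free of `g`. -/
lemma integral_prod_integral_eq_sum (HP : Measure (ProbabilityMeasure 𝒜)) [IsProbabilityMeasure HP]
    {n : ℕ} (g : Fin n → 𝒜 → ℝ) :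
    ∫ P, ∏ i, ∫ a, g i a ∂(P : Measure 𝒜) ∂HP =
      ∑ α : Fin n → 𝒜, mixtureWeight HP α * ∏ i, g i (α i) := by
  simp_rw [integral_eq_sum_real_mul, Fintype.prod_sum, Finset.prod_mul_distrib, mixtureWeight]
  rw [integral_finsetSum]
  · simp_rw [integral_mul_const]
  · intro α _
    refine (integrable_of_abs_le (C := 1) ?_ fun P => ?_).mul_const _
    · exact Finset.measurable_prod _ fun i _ => measurable_real_singleton _
    · rw [Finset.abs_prod]
      refine Finset.prod_le_one (fun _ _ => abs_nonneg _) fun i _ => ?_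
      rw [abs_of_nonneg measureReal_nonneg]
      exact measureReal_le_one

lemma sum_mixtureWeight (HP : Measure (ProbabilityMeasure 𝒜)) [IsProbabilityMeasure HP] (n : ℕ) :
    ∑ α : Fin n → 𝒜, mixtureWeight HP α = 1 := by
  simpa using (integral_prod_integral_eq_sum HP (fun (_ : Fin n) (_ : 𝒜) => (1 : ℝ))).symm

/-- Two-level change of measure: from the hyperprior to the hyperposterior, and from each prior to
the posteriors. -/
lemma integral_sum_posterior_le (HP HQ : Measure (ProbabilityMeasure 𝒜)) [IsProbabilityMeasure HP]
    [IsProbabilityMeasure HQ] {n m : ℕ} (h : Fin n → 𝒜 → ℝ)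
    (Q : Fin n → Fin m → ProbabilityMeasure 𝒜 → ProbabilityMeasure 𝒜)
    (hQ : ∀ i j, Measurable (Q i j)) {B : ℝ}
    (hB : ∑ α : Fin n → 𝒜, mixtureWeight HP α * ∏ i, Real.exp (h i (α i)) ≤ B)
    (hkl : InformationTheory.klDiv HQ HP ≠ ∞)
    (hK : ∫⁻ P, ∑ i, ∑ j, InformationTheory.klDiv (Q i j P : Measure 𝒜) (P : Measure 𝒜) ∂HQ ≠ ∞) :
    ∫ P, ∑ i, ∑ j, ∫ a, h i a ∂(Q i j P : Measure 𝒜) ∂HQ ≤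
      m * ((InformationTheory.klDiv HQ HP).toReal + Real.log B) +
        (∫⁻ P, ∑ i, ∑ j,
          InformationTheory.klDiv (Q i j P : Measure 𝒜) (P : Measure 𝒜) ∂HQ).toReal := by
  obtain ⟨C, hC⟩ := exists_abs_le fun x : Fin n × 𝒜 => h x.1 x.2
  have hC' : ∀ i a, |h i a| ≤ C := fun i a => hC (i, a)
  set G : Fin n → ProbabilityMeasure 𝒜 → ℝ :=
    fun i P => Real.log (∫ a, Real.exp (h i a) ∂(P : Measure 𝒜)) with hG
  have hGm : ∀ i, Measurable (G i) := fun i =>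
    Real.measurable_log.comp (measurable_integral_action _)
  have hpos : ∀ i (P : ProbabilityMeasure 𝒜), 0 < ∫ a, Real.exp (h i a) ∂(P : Measure 𝒜) :=
    fun i P => integral_exp_pos .of_finite
  have hGb : ∀ i P, |G i P| ≤ C := by
    intro i P
    have hlo : Real.exp (-C) ≤ ∫ a, Real.exp (h i a) ∂(P : Measure 𝒜) := by
      have := integral_mono (μ := (P : Measure 𝒜)) (integrable_const (Real.exp (-C)))
        Integrable.of_finite fun a => Real.exp_le_exp.mpr (neg_le_of_abs_le (hC' i a))
      simpa using this
    have hhi : ∫ a, Real.exp (h i a) ∂(P : Measure 𝒜) ≤ Real.exp C := by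
      have := integral_mono (μ := (P : Measure 𝒜)) Integrable.of_finite
        (integrable_const (Real.exp C)) fun a => Real.exp_le_exp.mpr (le_of_abs_le (hC' i a))
      simpa using this
    exact abs_le.mpr ⟨(Real.le_log_iff_exp_le (hpos i P)).mpr hlo,
      (Real.log_le_iff_le_exp (hpos i P)).mpr hhi⟩
  have hinner : ∀ i j, Integrable (fun P => ∫ a, h i a ∂(Q i j P : Measure 𝒜)) HQ := fun i j =>
    integrable_of_abs_le ((measurable_integral_action (h i)).comp (hQ i j))
      fun P => abs_integral_action_le _ (hC' i)
  have hGi : ∀ i, Integrable (G i) HQ := fun i => integrable_of_abs_le (hGm i) (hGb i)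
  have hSG : Integrable (fun P => ∑ i, G i P) HQ := integrable_finsetSum _ fun i _ => hGi i
  have hSh : Integrable (fun P => ∑ i, ∑ j, ∫ a, h i a ∂(Q i j P : Measure 𝒜)) HQ :=
    integrable_finsetSum _ fun i _ => integrable_finsetSum _ fun j _ => hinner i j
  -- Donsker–Varadhan for hyperpriors with the function ∑ `G i`, whose exponential is the product of
  -- the inner integrals and hence averages to the mixture bounded by `B`.
  have hhyper : ∫ P, ∑ i, G i P ∂HQ ≤
      (InformationTheory.klDiv HQ HP).toReal + Real.log B := by
    refine (integral_le_toReal_klDiv_add_log (Finset.measurable_sum _ fun i _ => hGm i)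
      (C := n * C) (fun P => (Finset.abs_sum_le_sum_abs _ _).trans
        ((Finset.sum_le_sum fun i _ => hGb i P).trans_eq (by simp))) hkl).trans ?_
    gcongr
    · exact integral_exp_pos (integrable_of_abs_le (C := Real.exp (n * C))
        (Real.measurable_exp.comp (Finset.measurable_sum _ fun i _ => hGm i)) fun P => by
          rw [Real.abs_exp]
          exact Real.exp_le_exp.mpr ((Finset.sum_le_sum fun i _ =>
            le_of_abs_le (hGb i P)).trans_eq (by simp)))
    · refine le_trans (le_of_eq ?_) hB
      rw [← integral_prod_integral_eq_sum HP fun i a => Real.exp (h i a)]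
      refine integral_congr_ae (.of_forall fun P => ?_)
      simp only [Real.exp_sum, hG]
      exact Finset.prod_congr rfl fun i _ => Real.exp_log (hpos i P)
  -- Donsker–Varadhan for each (i, j). `G i` does not involve j, whence the factor m. Stated in
  -- `ℝ≥0∞`, it remains true for priors with an infinite divergence.
  have hpt : ∀ P, ENNReal.ofReal ((∑ i, ∑ j, ∫ a, h i a ∂(Q i j P : Measure 𝒜)) - m * ∑ i, G i P) ≤
      ∑ i, ∑ j, InformationTheory.klDiv (Q i j P : Measure 𝒜) (P : Measure 𝒜) := by
    intro P
    by_cases htop : ∃ i j, InformationTheory.klDiv (Q i j P : Measure 𝒜) (P : Measure 𝒜) = ∞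
    · obtain ⟨i, j, hij⟩ := htop
      have : ∑ i, ∑ j, InformationTheory.klDiv (Q i j P : Measure 𝒜) (P : Measure 𝒜) = ∞ :=
        ENNReal.sum_eq_top.mpr ⟨i, Finset.mem_univ _,
          ENNReal.sum_eq_top.mpr ⟨j, Finset.mem_univ _, hij⟩⟩
      rw [this]
      exact le_top
    push Not at htop
    refine ENNReal.ofReal_le_of_le_toReal ?_
    rw [ENNReal.toReal_sum fun i _ => ENNReal.sum_ne_top.mpr fun j _ => htop i j,
      Finset.mul_sum, ← Finset.sum_sub_distrib]
    refine Finset.sum_le_sum fun i _ => ?_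
    rw [ENNReal.toReal_sum fun j _ => htop i j]
    have : (m : ℝ) * G i P = ∑ _j : Fin m, G i P := by simp
    rw [this, ← Finset.sum_sub_distrib]
    refine Finset.sum_le_sum fun j _ => ?_
    rw [sub_le_iff_le_add]
    exact integral_le_toReal_klDiv_add_log .of_discrete (hC' i) (htop i j)
  have hdiff := hSh.sub (hSG.const_mul (m : ℝ))
  have hpost : ∫ P, ((∑ i, ∑ j, ∫ a, h i a ∂(Q i j P : Measure 𝒜)) - m * ∑ i, G i P) ∂HQ ≤
      (∫⁻ P, ∑ i, ∑ j,
        InformationTheory.klDiv (Q i j P : Measure 𝒜) (P : Measure 𝒜) ∂HQ).toReal := by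
    -- The integral is at most that of the positive part, so measurability of the divergence in P is
    -- not needed.
    refine le_trans ?_ (ENNReal.toReal_mono hK (lintegral_mono hpt))
    have := integral_eq_lintegral_pos_part_sub_lintegral_neg_part hdiff
    simp only [Pi.sub_apply] at this
    rw [this]
    exact sub_le_self _ ENNReal.toReal_nonneg
  rw [integral_sub hSh (hSG.const_mul _), integral_const_mul] at hpost
  have := mul_le_mul_of_nonneg_left hhyper (Nat.cast_nonneg (α := ℝ) m)
  linarith

end FiniteActions

/-! ### The exponential factor of a single step -/

section BernsteinFactor

variable {𝒜 : Type*} [MeasurableSpace 𝒜] {m : ℕ}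

open scoped Classical in
/-- The exponential Bernstein factor of one step for the action `c`, truncated to `1` when the
behaviour policy gives `c` a probability below `t`. -/
def bernsteinFactor (b : (i j : ℕ) → Kernel (History 𝒜 m i j) 𝒜) (ρ : ℕ → Kernel 𝒜 unitInterval)
    (t : ℝ) (c : ℕ → 𝒜) (i j : ℕ) (h : History 𝒜 m i j) (x : Obs 𝒜) : ℝ≥0∞ :=
  if t ≤ (b i j h).real {c i} then
    ENNReal.ofReal (Real.exp (t * (1 / (b i j h).real {c i} * x.2 * (if x.1 = c i then 1 else 0) -
      reward (ρ i) (c i)) - (Real.exp 1 - 2) * t ^ 2 / (b i j h).real {c i}))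
  else 1

lemma reward_le_one (ρ : Kernel 𝒜 unitInterval) [IsMarkovKernel ρ] (a : 𝒜) : reward ρ a ≤ 1 := by
  have : reward ρ a ≤ ∫ _, (1 : ℝ) ∂(ρ a) :=
    integral_mono_of_nonneg (.of_forall fun r => r.2.1) (integrable_const _)
      (.of_forall fun r => r.2.2)
  simpa using this

variable [MeasurableSingletonClass 𝒜]

open scoped Classical in
lemma measurable_ite_eq (c : 𝒜) : Measurable fun a : 𝒜 => if a = c then (1 : ℝ) else 0 :=
  Measurable.ite (measurableSet_singleton c) measurable_const measurable_const

lemma measurable_bernsteinFactor (b : (i j : ℕ) → Kernel (History 𝒜 m i j) 𝒜)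
    (ρ : ℕ → Kernel 𝒜 unitInterval) (t : ℝ) (c : ℕ → 𝒜) (i j : ℕ) :
    Measurable fun x : History 𝒜 m i j × Obs 𝒜 => bernsteinFactor b ρ t c i j x.1 x.2 := by
  have hp : Measurable fun x : History 𝒜 m i j × Obs 𝒜 => (b i j x.1).real {c i} :=
    (((b i j).measurable_coe (measurableSet_singleton (c i))).ennreal_toReal).comp measurable_fst
  have hr : Measurable fun x : History 𝒜 m i j × Obs 𝒜 => (x.2.2 : ℝ) :=
    measurable_subtype_coe.comp (measurable_snd.comp measurable_snd)
  have ha : Measurable fun x : History 𝒜 m i j × Obs 𝒜 => x.2.1 :=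
    measurable_fst.comp measurable_snd
  have hi := (measurable_ite_eq (c i)).comp ha
  unfold bernsteinFactor
  refine Measurable.ite (measurableSet_le measurable_const hp) ?_ measurable_const
  refine ENNReal.measurable_ofReal.comp (Real.measurable_exp.comp ?_)
  exact (((((hp.const_div 1).mul hr).mul hi).sub_const _).const_mul t).sub (hp.const_div _)

/-- Below the cutoff the factor is 1. Otherwise Bernstein's bound applies, as importance weighting
is unbiased: only `c i` contributes, and its probability p cancels the weight 1/p. -/
lemma lintegral_bernsteinFactor_le_one [Fintype 𝒜] (b : (i j : ℕ) → Kernel (History 𝒜 m i j) 𝒜)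
    (ρ : ℕ → Kernel 𝒜 unitInterval) [∀ i j, IsMarkovKernel (b i j)] [∀ i, IsMarkovKernel (ρ i)]
    {t : ℝ} (ht : 0 < t) (c : ℕ → 𝒜) (i j : ℕ) (h : History 𝒜 m i j) :
    ∫⁻ x, bernsteinFactor b ρ t c i j h x ∂((b i j ⊗ₖ Kernel.prodMkLeft _ (ρ i)) h) ≤ 1 := by
  classical
  unfold bernsteinFactor
  by_cases htp : t ≤ (b i j h).real {c i}
  swap
  · simp [htp]
  simp only [htp, if_true]
  set p := (b i j h).real {c i} with hp
  have hp0 : 0 < p := ht.trans_le htp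
  have hi : ∀ a : 𝒜, 0 ≤ (if a = c i then (1 : ℝ) else 0) ∧ (if a = c i then (1 : ℝ) else 0) ≤ 1 :=
    fun a => by split_ifs <;> simp
  have hU : Measurable fun x : Obs 𝒜 => 1 / p * (x.2 : ℝ) * (if x.1 = c i then (1 : ℝ) else 0) :=
    ((measurable_subtype_coe.comp measurable_snd).const_mul _).mul
      ((measurable_ite_eq (c i)).comp measurable_fst)
  have hU0 : ∀ x : Obs 𝒜, 0 ≤ 1 / p * (x.2 : ℝ) * (if x.1 = c i then (1 : ℝ) else 0) := fun x =>
    mul_nonneg (mul_nonneg (by positivity) x.2.2.1) (hi x.1).1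
  have hU1 : ∀ x : Obs 𝒜, 1 / p * (x.2 : ℝ) * (if x.1 = c i then (1 : ℝ) else 0) ≤ 1 / p :=
    fun x => (mul_le_of_le_one_right (mul_nonneg (by positivity) x.2.2.1) (hi x.1).2).trans
      (mul_le_of_le_one_right (by positivity) x.2.2.2)
  refine lintegral_exp_bernstein_le_one hU hp0 hU0 hU1 ?_ (reward_le_one _ _) ht.le htp
  rw [integral_compProd (integrable_of_abs_le hU (C := 1 / p) fun x => by
    rw [abs_of_nonneg (hU0 x)]; exact hU1 x)]
  have hinner : ∀ a, ∫ r, 1 / p * (r : ℝ) * (if a = c i then (1 : ℝ) else 0) ∂(ρ i a) =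
      1 / p * reward (ρ i) a * (if a = c i then (1 : ℝ) else 0) := fun a => by
    rw [integral_mul_const, integral_const_mul]
    rfl
  simp only [Kernel.prodMkLeft_apply, hinner]
  rw [integral_fintype .of_finite, Finset.sum_eq_single (c i) (fun a _ ha => by simp [ha])
    (fun h => absurd (Finset.mem_univ _) h), if_pos rfl, smul_eq_mul, mul_one, ← mul_assoc, ← hp,
    mul_one_div_cancel hp0.ne', one_mul]

end BernsteinFactor

/-! ### Replacing the behaviour probabilities by the observed minimum -/

section DataDependentBound

variable {𝒜 : Type*} [Fintype 𝒜] [MeasurableSpace 𝒜] {n m : ℕ}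
  (b : (i j : ℕ) → Kernel (History 𝒜 m i j) 𝒜) (ρ : ℕ → Kernel 𝒜 unitInterval)
  (D : Fin n → DataSet 𝒜 m)

lemma bMin_le_behaviourProb (i : Fin n) (j : Fin m) (a : 𝒜) :
    bMin b D ≤ behaviourProb b D i j a :=
  ciInf_le (f := fun t : Fin n × Fin m × 𝒜 => behaviourProb b D t.1 t.2.1 t.2.2)
    (Set.finite_range _).bddBelow (i, j, a)

/-- The scaled excess of the empirical over the expected reward, compensated by the variance
term. -/
def compensatedExcess (lam : ℝ) (i : Fin n) (a : 𝒜) : ℝ :=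
  lam * (empReward b D i a - reward (ρ i) a) - (Real.exp 1 - 2) * lam ^ 2 / (m * bMin b D)

open scoped Classical in
-- `hb` puts λ/m below every behaviour probability, so the cutoff is inactive and 1/p ≤ 1/b_min. The
-- m variance terms (λ/m)²/b_min add up to λ²/(m b_min).
lemma ofReal_exp_compensatedExcess_le (hm : 0 < m) {lam : ℝ} (hlam : 0 < lam)
    (hb : lam ≤ m * bMin b D) (c : ℕ → 𝒜) (i : Fin n) :
    ENNReal.ofReal (Real.exp (compensatedExcess b ρ D lam i (c i))) ≤
      ∏ j : Fin m, bernsteinFactor b ρ (lam / m) c i j (history D i j) (D i j) := by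
  have hm' : (0 : ℝ) < m := Nat.cast_pos.mpr hm
  have hb0 : 0 < bMin b D := pos_of_mul_pos_right (hlam.trans_le hb) hm'.le
  have he := Real.quadratic_le_exp_of_nonneg zero_le_one
  have hfac : ∀ j : Fin m, ENNReal.ofReal (Real.exp (lam / m *
      (1 / behaviourProb b D i j (D i j).1 * ((D i j).2 : ℝ) * (if (D i j).1 = c i then 1 else 0) -
        reward (ρ i) (c i)) - (Real.exp 1 - 2) * (lam / m) ^ 2 / bMin b D)) ≤
      bernsteinFactor b ρ (lam / m) c i j (history D i j) (D i j) := by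
    intro j
    have hle := bMin_le_behaviourProb b D i j (c i)
    have hcond : lam / m ≤ (b i j (history D i j)).real {c i} := by
      refine le_trans ?_ hle
      rw [div_le_iff₀ hm']
      linarith
    rw [bernsteinFactor, if_pos hcond]
    refine ENNReal.ofReal_le_ofReal (Real.exp_le_exp.mpr (sub_le_sub (le_of_eq ?_) ?_))
    -- The estimate divides by the probability of the observed action, the factor by that of `c i`;
    -- they differ only where the indicator vanishes.
    · by_cases hc : (D i j).1 = c i
      · rw [hc]; rfl
      · simp [hc]
    · refine div_le_div_of_nonneg_left ?_ hb0 hle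
      have : 0 ≤ Real.exp 1 - 2 := by linarith
      positivity
  refine le_trans (le_of_eq ?_) (Finset.prod_le_prod' fun j _ => hfac j)
  rw [← ENNReal.ofReal_prod_of_nonneg fun j _ => (Real.exp_pos _).le, ← Real.exp_sum]
  congr 2
  rw [Finset.sum_sub_distrib, ← Finset.mul_sum, Finset.sum_sub_distrib, compensatedExcess,
    empReward]
  simp only [Finset.sum_const, Finset.card_univ, Fintype.card_fin, nsmul_eq_mul]
  field_simp

lemma ofReal_exp_sum_compensatedExcess_le (hm : 0 < m) {lam : ℝ} (hlam : 0 < lam)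
    (hb : lam ≤ m * bMin b D) (c : ℕ → 𝒜) :
    ENNReal.ofReal (∏ i : Fin n, Real.exp (compensatedExcess b ρ D lam i (c i))) ≤
      historyProd (bernsteinFactor b ρ (lam / m) c) D := by
  rw [ENNReal.ofReal_prod_of_nonneg fun i _ => (Real.exp_pos _).le]
  exact Finset.prod_le_prod' fun i _ => ofReal_exp_compensatedExcess_le b ρ D hm hlam hb c i

variable [MeasurableSingletonClass 𝒜]

lemma integrable_integral_posterior (HQ : Measure (ProbabilityMeasure 𝒜)) [IsFiniteMeasure HQ]
    {Q : ProbabilityMeasure 𝒜 → ProbabilityMeasure 𝒜} (hQ : Measurable Q) (f : 𝒜 → ℝ) :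
    Integrable (fun P => ∫ a, f a ∂(Q P : Measure 𝒜)) HQ := by
  obtain ⟨C, hC⟩ := exists_abs_le f
  exact integrable_of_abs_le ((measurable_integral_action f).comp hQ)
    fun P => abs_integral_action_le _ hC

lemma integral_sum_compensatedExcess (hn : 0 < n) (hm : 0 < m) (A : LearningAlgorithm 𝒜)
    (hA : ∀ (k : ℕ) (d : DataSet 𝒜 k), Measurable (A k d))
    (HQ : Measure (ProbabilityMeasure 𝒜)) [IsProbabilityMeasure HQ] (lam : ℝ) :
    ∫ P, ∑ i : Fin n, ∑ j : Fin m, ∫ a, compensatedExcess b ρ D lam i a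
        ∂(A j (truncate (D i) j) P : Measure 𝒜) ∂HQ =
      lam * (n * m) * (empMultiTaskReward A b D HQ - expMultiTaskReward A ρ D HQ) -
        n * m * ((Real.exp 1 - 2) * lam ^ 2 / (m * bMin b D)) := by
  have hn' : (n : ℝ) ≠ 0 := Nat.cast_ne_zero.mpr hn.ne'
  have hm' : (m : ℝ) ≠ 0 := Nat.cast_ne_zero.mpr hm.ne'
  have hint : ∀ f : Fin n → 𝒜 → ℝ, Integrable (fun P => (1 / n : ℝ) * ∑ i : Fin n,
      (1 / m : ℝ) * ∑ j : Fin m, ∫ a, f i a ∂(A j (truncate (D i) j) P : Measure 𝒜)) HQ := fun f =>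
    (integrable_finsetSum _ fun i _ => (integrable_finsetSum _ fun j _ =>
      integrable_integral_posterior HQ (hA _ _) (f i)).const_mul _).const_mul _
  unfold empMultiTaskReward expMultiTaskReward
  rw [← integral_sub (hint _) (hint fun i a => reward (ρ i) a), ← integral_const_mul]
  have hconst : n * m * ((Real.exp 1 - 2) * lam ^ 2 / (m * bMin b D)) = ∫ _,
      n * m * ((Real.exp 1 - 2) * lam ^ 2 / (m * bMin b D)) ∂HQ := by simp
  have hdiff := ((hint fun i a => empReward b D i a).sub
    (hint fun i a => reward (ρ i) a)).const_mul (lam * (n * m))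
  simp only [Pi.sub_apply] at hdiff
  rw [hconst, ← integral_sub hdiff (integrable_const _)]
  refine integral_congr_ae (.of_forall fun P => ?_)
  have hpost : ∀ (i : Fin n) (j : Fin m), ∫ a, compensatedExcess b ρ D lam i a
      ∂(A j (truncate (D i) j) P : Measure 𝒜) =
      lam * (∫ a, empReward b D i a ∂(A j (truncate (D i) j) P : Measure 𝒜) -
        ∫ a, reward (ρ i) a ∂(A j (truncate (D i) j) P : Measure 𝒜)) -
        (Real.exp 1 - 2) * lam ^ 2 / (m * bMin b D) := by
    intro i j
    unfold compensatedExcess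
    rw [integral_sub .of_finite .of_finite, integral_const_mul,
      integral_sub .of_finite .of_finite]
    simp
  simp only [hpost, Finset.sum_sub_distrib, ← Finset.mul_sum, Finset.sum_const, Finset.card_univ,
    Fintype.card_fin, nsmul_eq_mul]
  field_simp

end DataDependentBound

/-! ### The high-probability event and the real-valued bound -/

section HighProbability

/-- An extension of a finite sequence of actions to all task indices. -/
def extendActions {𝒜 : Type*} {n : ℕ} (hn : 0 < n) (α : Fin n → 𝒜) (i : ℕ) : 𝒜 := α ⟨i % n, Nat.mod_lt _ hn⟩

lemma extendActions_coe {𝒜 : Type*} {n : ℕ} (hn : 0 < n) (α : Fin n → 𝒜) (i : Fin n) :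
    extendActions hn α i = α i := by
  simp [extendActions, Nat.mod_eq_of_lt i.isLt]

variable {𝒜 : Type*} [Fintype 𝒜] [MeasurableSpace 𝒜] {n m : ℕ}

/-- The mixture over sequences of actions of the products of Bernstein factors. -/
def mixtureFactor (hn : 0 < n) (b : (i j : ℕ) → Kernel (History 𝒜 m i j) 𝒜)
    (ρ : ℕ → Kernel 𝒜 unitInterval) (HP : Measure (ProbabilityMeasure 𝒜)) (t : ℝ)
    (D : Fin n → DataSet 𝒜 m) : ℝ≥0∞ :=
  ∑ α : Fin n → 𝒜, ENNReal.ofReal (mixtureWeight HP α) *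
    historyProd (bernsteinFactor b ρ t (extendActions hn α)) D

lemma sum_mixtureWeight_mul_exp_le (hn : 0 < n) (hm : 0 < m)
    (b : (i j : ℕ) → Kernel (History 𝒜 m i j) 𝒜) (ρ : ℕ → Kernel 𝒜 unitInterval)
    (HP : Measure (ProbabilityMeasure 𝒜)) {lam : ℝ} (hlam : 0 < lam) {B : ℝ} (hB : 0 ≤ B)
    {D : Fin n → DataSet 𝒜 m} (hD : mixtureFactor hn b ρ HP (lam / m) D ≤ ENNReal.ofReal B)
    (hb : lam ≤ m * bMin b D) :
    ∑ α : Fin n → 𝒜, mixtureWeight HP α *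
      ∏ i, Real.exp (compensatedExcess b ρ D lam i (α i)) ≤ B := by
  rw [← ENNReal.ofReal_le_ofReal_iff hB]
  refine le_trans ?_ hD
  rw [ENNReal.ofReal_sum_of_nonneg fun α _ => mul_nonneg (mixtureWeight_nonneg HP α)
    (Finset.prod_nonneg fun i _ => (Real.exp_pos _).le)]
  refine Finset.sum_le_sum fun α _ => ?_
  rw [ENNReal.ofReal_mul (mixtureWeight_nonneg HP α)]
  gcongr
  simpa only [extendActions_coe] using
    ofReal_exp_sum_compensatedExcess_le b ρ D hm hlam hb (extendActions hn α)

variable [MeasurableSingletonClass 𝒜]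

lemma measurable_mixtureFactor (hn : 0 < n) (b : (i j : ℕ) → Kernel (History 𝒜 m i j) 𝒜)
    (ρ : ℕ → Kernel 𝒜 unitInterval) (HP : Measure (ProbabilityMeasure 𝒜)) (t : ℝ) :
    Measurable (mixtureFactor hn b ρ HP t) :=
  Finset.measurable_sum _ fun _ _ =>
    (measurable_historyProd (measurable_bernsteinFactor b ρ t _) n).const_mul _

lemma lintegral_mixtureFactor_le_one (hn : 0 < n) (b : (i j : ℕ) → Kernel (History 𝒜 m i j) 𝒜)
    (ρ : ℕ → Kernel 𝒜 unitInterval) [∀ i j, IsMarkovKernel (b i j)] [∀ i, IsMarkovKernel (ρ i)]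
    (HP : Measure (ProbabilityMeasure 𝒜)) [IsProbabilityMeasure HP] {t : ℝ} (ht : 0 < t) :
    ∫⁻ D, mixtureFactor hn b ρ HP t D ∂(trainingLaw b ρ n) ≤ 1 := by
  have hmeas := fun α : Fin n → 𝒜 =>
    measurable_historyProd (measurable_bernsteinFactor b ρ t (extendActions hn α)) n
  unfold mixtureFactor
  rw [lintegral_finsetSum _ fun α _ => (hmeas α).const_mul _]
  calc _ ≤ ∑ α : Fin n → 𝒜, ENNReal.ofReal (mixtureWeight HP α) := by
        refine Finset.sum_le_sum fun α _ => ?_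
        rw [lintegral_const_mul _ (hmeas α)]
        exact mul_le_of_le_one_right' (lintegral_historyProd_trainingLaw_le_one
          (measurable_bernsteinFactor b ρ t _) (lintegral_bernsteinFactor_le_one b ρ ht _) n)
    _ = 1 := by
        rw [← ENNReal.ofReal_sum_of_nonneg fun α _ => mixtureWeight_nonneg HP α,
          sum_mixtureWeight, ENNReal.ofReal_one]

/-- Markov's inequality. The event involves the hyperprior but no hyperposterior, which is what
makes the final bound uniform in the latter. -/
lemma ofReal_one_sub_le_trainingLaw (hn : 0 < n) (b : (i j : ℕ) → Kernel (History 𝒜 m i j) 𝒜)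
    (ρ : ℕ → Kernel 𝒜 unitInterval) [∀ i j, IsMarkovKernel (b i j)] [∀ i, IsMarkovKernel (ρ i)]
    (HP : Measure (ProbabilityMeasure 𝒜)) [IsProbabilityMeasure HP] {t : ℝ} (ht : 0 < t) {δ : ℝ}
    (hδ : 0 < δ) :
    ENNReal.ofReal (1 - δ) ≤
      trainingLaw b ρ n {D | mixtureFactor hn b ρ HP t D ≤ ENNReal.ofReal (1 / δ)} := by
  have hmeas := measurable_mixtureFactor hn b ρ HP t
  have hE : MeasurableSet {D | mixtureFactor hn b ρ HP t D ≤ ENNReal.ofReal (1 / δ)} :=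
    measurableSet_le hmeas measurable_const
  rw [ENNReal.ofReal_sub _ hδ.le, ENNReal.ofReal_one, tsub_le_iff_right,
    ← prob_add_prob_compl (μ := trainingLaw b ρ n) hE]
  gcongr
  calc trainingLaw b ρ n {D | mixtureFactor hn b ρ HP t D ≤ ENNReal.ofReal (1 / δ)}ᶜ
    _ ≤ trainingLaw b ρ n {D | ENNReal.ofReal (1 / δ) ≤ mixtureFactor hn b ρ HP t D} :=
        measure_mono fun D hD => le_of_lt (not_le.mp (Set.notMem_ofPred_iff.mp hD))
    _ ≤ (∫⁻ D, mixtureFactor hn b ρ HP t D ∂(trainingLaw b ρ n)) / ENNReal.ofReal (1 / δ) :=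
        meas_ge_le_lintegral_div hmeas.aemeasurable
          (ENNReal.ofReal_pos.mpr (one_div_pos.mpr hδ)).ne' ENNReal.ofReal_ne_top
    _ ≤ 1 / ENNReal.ofReal (1 / δ) := by
        gcongr
        exact lintegral_mixtureFactor_le_one hn b ρ HP ht
    _ = ENNReal.ofReal δ := by
        rw [one_div, one_div, ENNReal.ofReal_inv_of_pos hδ, inv_inv]

/-- The change-of-measure inequality divided by λnm. The hyper-level divergence and log `B` carry a
factor m there, so they end with denominator nλ. -/
lemma empMultiTaskReward_sub_le (hn : 0 < n) (hm : 0 < m)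
    (b : (i j : ℕ) → Kernel (History 𝒜 m i j) 𝒜) (ρ : ℕ → Kernel 𝒜 unitInterval)
    (A : LearningAlgorithm 𝒜) (hA : ∀ (k : ℕ) (d : DataSet 𝒜 k), Measurable (A k d))
    (HP HQ : Measure (ProbabilityMeasure 𝒜)) [IsProbabilityMeasure HP] [IsProbabilityMeasure HQ]
    {lam : ℝ} (hlam : 0 < lam) {B : ℝ} (hB : 0 ≤ B)
    {D : Fin n → DataSet 𝒜 m} (hD : mixtureFactor hn b ρ HP (lam / m) D ≤ ENNReal.ofReal B)
    (hb : lam ≤ m * bMin b D) (hkl : InformationTheory.klDiv HQ HP ≠ ∞)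
    (hK : expPosteriorKL A D HQ ≠ ∞) :
    empMultiTaskReward A b D HQ - (InformationTheory.klDiv HQ HP).toReal / (n * lam) -
      (expPosteriorKL A D HQ).toReal / (n * m * lam) -
      lam * (Real.exp 1 - 2) / (bMin b D * m) - Real.log B / (n * lam) ≤
    expMultiTaskReward A ρ D HQ := by
  have hn' : (0 : ℝ) < n := Nat.cast_pos.mpr hn
  have hm' : (0 : ℝ) < m := Nat.cast_pos.mpr hm
  have hb0 : 0 < bMin b D := pos_of_mul_pos_right (hlam.trans_le hb) hm'.le
  have key := integral_sum_posterior_le HP HQ (compensatedExcess b ρ D lam)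
    (fun i j => A j (truncate (D i) j)) (fun i j => hA _ _)
    (sum_mixtureWeight_mul_exp_le hn hm b ρ HP hlam hB hD hb) hkl hK
  rw [integral_sum_compensatedExcess b ρ D hn hm A hA HQ lam] at key
  change _ ≤ _ + (expPosteriorKL A D HQ).toReal at key
  set k := (InformationTheory.klDiv HQ HP).toReal
  set K := (expPosteriorKL A D HQ).toReal
  have h := div_le_div_of_nonneg_right key (by positivity : 0 ≤ lam * (n * m))
  have h1 : (lam * (n * m) * (empMultiTaskReward A b D HQ - expMultiTaskReward A ρ D HQ) -
      n * m * ((Real.exp 1 - 2) * lam ^ 2 / (m * bMin b D))) / (lam * (n * m)) =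
      empMultiTaskReward A b D HQ - expMultiTaskReward A ρ D HQ -
        lam * (Real.exp 1 - 2) / (bMin b D * m) := by
    field_simp
  have h2 : (m * (k + Real.log B) + K) / (lam * (n * m)) =
      k / (n * lam) + Real.log B / (n * lam) + K / (n * m * lam) := by
    field_simp
  rw [h1, h2] at h
  linarith

end HighProbability

/-! ### Extended-real form of the bound -/

lemma _root_.EReal.coe_ennreal_div_ofReal {x : ℝ≥0∞} (hx : x ≠ ∞) {c : ℝ} (hc : 0 < c) :
    ((x / ENNReal.ofReal c : ℝ≥0∞) : EReal) = ((x.toReal / c : ℝ) : EReal) := by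
  rw [← ENNReal.ofReal_toReal hx, ← ENNReal.ofReal_div_of_pos hc, EReal.coe_ennreal_ofReal,
    max_eq_left (by positivity), ENNReal.toReal_ofReal ENNReal.toReal_nonneg]

end LifelongBandit
end

/-- PAC-Bayesian Bernstein bound for the multi-task reward. The right-hand side takes values in the
extended reals, since the KL divergences may be infinite; for `lam = 0` the quotients by `n * lam`
and `n * m * lam` are `∞` (unless their numerators vanish). -/
theorem lemma6 {𝒜 : Type*} [Fintype 𝒜] [MeasurableSpace 𝒜] [MeasurableSingletonClass 𝒜]
    (n m : ℕ) (hn : 0 < n) (hm : 0 < m)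
    (ρ : ℕ → Kernel 𝒜 unitInterval) [∀ i, IsMarkovKernel (ρ i)]
    (b : (i j : ℕ) → Kernel (LifelongBandit.History 𝒜 m i j) 𝒜) [∀ i j, IsMarkovKernel (b i j)]
    (A : LifelongBandit.LearningAlgorithm 𝒜)
    (hA : ∀ (k : ℕ) (d : LifelongBandit.DataSet 𝒜 k), Measurable (A k d))
    (HP : Measure (ProbabilityMeasure 𝒜)) [IsProbabilityMeasure HP]
    (lam : ℝ) (hlam : 0 ≤ lam) (δ : ℝ) (hδ : 0 < δ) (hδ1 : δ ≤ 1) :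
    ∃ E : Set (Fin n → LifelongBandit.DataSet 𝒜 m), MeasurableSet E ∧
      ENNReal.ofReal (1 - δ) ≤ LifelongBandit.trainingLaw b ρ n E ∧
      ∀ D ∈ E, lam ≤ m * LifelongBandit.bMin b D →
        ∀ HQ : Measure (ProbabilityMeasure 𝒜), IsProbabilityMeasure HQ →
          (LifelongBandit.expMultiTaskReward A ρ D HQ : EReal) ≥
            (LifelongBandit.empMultiTaskReward A b D HQ : EReal)
            - ((InformationTheory.klDiv HQ HP / ENNReal.ofReal (n * lam) : ℝ≥0∞) : EReal)
            - ((LifelongBandit.expPosteriorKL A D HQ / ENNReal.ofReal (n * m * lam) : ℝ≥0∞) : EReal)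
            - ((lam * (Real.exp 1 - 2) / (LifelongBandit.bMin b D * m) : ℝ) : EReal)
            - ((ENNReal.ofReal (Real.log (m / δ)) / ENNReal.ofReal (n * lam) : ℝ≥0∞) : EReal) := by
  have hm1 : (1 : ℝ) ≤ m := Nat.one_le_cast.mpr hm
  have hn' : (0 : ℝ) < n := Nat.cast_pos.mpr hn
  rcases hlam.eq_or_lt with rfl | hlam
  · rcases hδ1.eq_or_lt with rfl | hδ1
    -- For δ = 1 the empty event suffices. This case is separate because ln(m/δ) vanishes when m =
    -- 1, and then 0/0 = 0 gives no infinite term.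
    · exact ⟨∅, .empty, by simp, fun D hD => absurd hD (Set.notMem_empty D)⟩
    · refine ⟨Set.univ, .univ, by simp [hδ.le], fun D _ _ HQ _ => ?_⟩
      have hlog : 0 < Real.log (m / δ) := Real.log_pos ((one_lt_div hδ).mpr (hδ1.trans_le hm1))
      have htop : ENNReal.ofReal (Real.log (m / δ)) / ENNReal.ofReal (n * 0) = ∞ := by
        rw [mul_zero, ENNReal.ofReal_zero, ENNReal.div_zero (ENNReal.ofReal_pos.mpr hlog).ne']
      rw [htop, EReal.coe_ennreal_top, EReal.sub_top]
      exact bot_le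
  · have hmpos : (0 : ℝ) < m := Nat.cast_pos.mpr hm
    refine ⟨{D | LifelongBandit.mixtureFactor hn b ρ HP (lam / m) D ≤ ENNReal.ofReal (1 / δ)},
      measurableSet_le (LifelongBandit.measurable_mixtureFactor hn b ρ HP _) measurable_const,
      LifelongBandit.ofReal_one_sub_le_trainingLaw hn b ρ HP (by positivity) hδ,
      fun D hD hb HQ _ => ?_⟩
    by_cases hkl : InformationTheory.klDiv HQ HP = ∞
    · rw [hkl, ENNReal.top_div_of_ne_top ENNReal.ofReal_ne_top, EReal.coe_ennreal_top,
        EReal.sub_top]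
      simp
    by_cases hK : LifelongBandit.expPosteriorKL A D HQ = ∞
    · rw [hK, ENNReal.top_div_of_ne_top ENNReal.ofReal_ne_top, EReal.coe_ennreal_top,
        EReal.sub_top]
      simp
    -- The event gives the threshold 1/δ; it is weakened to m/δ only to match the stated logarithm.
    have hD' : LifelongBandit.mixtureFactor hn b ρ HP (lam / m) D ≤ ENNReal.ofReal (m / δ) :=
      le_trans hD (ENNReal.ofReal_le_ofReal (by gcongr))
    have hlog : 0 ≤ Real.log (m / δ) := Real.log_nonneg ((one_le_div hδ).mpr (hδ1.trans hm1))
    rw [EReal.coe_ennreal_div_ofReal hkl (by positivity),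
      EReal.coe_ennreal_div_ofReal hK (by positivity),
      EReal.coe_ennreal_div_ofReal ENNReal.ofReal_ne_top (by positivity),
      ENNReal.toReal_ofReal hlog]
    exact_mod_cast LifelongBandit.empMultiTaskReward_sub_le hn hm b ρ A hA HP HQ hlam
      (by positivity) hD' hb hkl hK
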